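/- Let $L$ be a finite-dimensional restricted Lie algebra over a field $\mathbb{F}$ of prime characteristic $p$, with $p$-map $x\mapsto x^{[p]}$. Let $u(L)$ be its restricted universal enveloping algebra, i.e. the quotient of the universal enveloping algebra $U(L)$ by the two-sided ideal generated by all $x^p-x^{[p]}$ ($x\in L$), and identify restricted $L$-modules (those on which $x^{[p]}$ acts as the $p$-th power of the action of $x$) with $u(L)$-modules. Let $J=\mathrm{Jac}(u(L))$ be the Jacobson radical, and let $P_L(\mathbb{F})$ be the projective cover of the trivial irreducible module $\mathbb{F}$: a projective $u(L)$-module with a $u(L)$-module epimorphism $\pi:P_L(\mathbb{F})\to\mathbb{F}$ such that $\ker\pi\subseteq J P_L(\mathbb{F})$. Let $S$ be a non-trivial irreducible restricted $L$-module, and let $0=L_0\subset L_1\subset\cdots\subset L_n=L$ be any chief series of $L$, i.e. a chain of ideals of $L$ such that each $L_j/L_{j-1}$ is a minimal non-zero ideal of $L/L_{j-1}$. Let $[L:S]_{\mathrm{split}}$ be the number of indices $j$ with $1\le j\le n$ such that $L_j/L_{j-1}$ is an abelian Lie algebra, $L_j/L_{j-1}\cong S$ as $L$-modules, and the exact sequence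 $0\to L_j/L_{j-1}\to L/L_{j-1}\to L/L_j\to 0$ splits in the category of Lie algebras. Then $$[JP_L(\mathbb{F})/J^2P_L(\mathbb{F}):S]\ \ge\ [L:S]_{\mathrm{split}},$$ where $[M:S]$ denotes the multiplicity of $S$ as a composition factor of the $u(L)$-module $M$. -/

import Mathlib

open scoped Polynomial

noncomputable section

namespace RestrictedLie

/-! ### Restricted Lie algebras and the restricted universal enveloping algebra -/

section Restricted

variable (F : Type*) {L : Type*} [Field F] [LieRing L] [LieAlgebra F L]

/-- Jacobson's Lie polynomials `s_i(x, y)`: `i • s_i(x, y)` is the coefficient of `T ^ (i - 1)` in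
`(ad (T x + y)) ^ (p - 1) (x)`, where `T` is a commuting indeterminate. -/
def jacobsonPoly (p i : ℕ) (x y : L) : L :=
  (i : F)⁻¹ •
    ((((Polynomial.C (LieAlgebra.ad F L x) * Polynomial.X + Polynomial.C (LieAlgebra.ad F L y) :
      (Module.End F L)[X]) ^ (p - 1)).coeff (i - 1)) x)

variable (L) in
/-- A `p`-map `x ↦ x^[p]` on the Lie algebra `L`, i.e. the structure of a restricted Lie algebra
(used for `F` of prime characteristic `p`). -/
structure PMap (p : ℕ) where
  /-- The map `x ↦ x^[p]`. -/
  toFun : L → L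
  smul' : ∀ (a : F) (x : L), toFun (a • x) = a ^ p • toFun x
  ad' : ∀ x : L, LieAlgebra.ad F L (toFun x) = LieAlgebra.ad F L x ^ p
  add' : ∀ x y : L, toFun (x + y) =
    toFun x + toFun y + ∑ i ∈ Finset.Icc 1 (p - 1), jacobsonPoly F p i x y

variable {F} {p : ℕ}

/-- The relations `x ^ p = x^[p]` in the universal enveloping algebra. -/
inductive PMap.Rel (φ : PMap F L p) :
    UniversalEnvelopingAlgebra F L → UniversalEnvelopingAlgebra F L → Prop
  | pow (x : L) : PMap.Rel φ (UniversalEnvelopingAlgebra.ι F x ^ p)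
      (UniversalEnvelopingAlgebra.ι F (φ.toFun x))

/-- The restricted universal enveloping algebra `u(L)`: the quotient of `U(L)` by the two-sided
ideal generated by all `x ^ p - x^[p]`. -/
abbrev PMap.Env (φ : PMap F L p) : Type _ := RingQuot φ.Rel

/-- A restricted `L`-module: an `L`-module on which `x^[p]` acts as the `p`-th power of the action
of `x`. -/
class IsRestrictedModule (φ : PMap F L p) (V : Type*) [AddCommGroup V] [Module F V]
    [LieRingModule L V] [LieModule F L V] : Prop where
  toEnd_pMap : ∀ x : L, LieModule.toEnd F L V (φ.toFun x) = LieModule.toEnd F L V x ^ p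

section AsModule

variable (φ : PMap F L p) (V : Type*) [AddCommGroup V] [Module F V]
  [LieRingModule L V] [LieModule F L V] [IsRestrictedModule φ V]

/-- The algebra homomorphism `u(L) → End_F(V)` that extends the action of `L` on a restricted
`L`-module `V`. -/
def action : φ.Env →ₐ[F] Module.End F V :=
  RingQuot.liftAlgHom F ⟨UniversalEnvelopingAlgebra.lift F (LieModule.toEnd F L V), by
    rintro _ _ ⟨x⟩
    rw [map_pow, UniversalEnvelopingAlgebra.lift_ι_apply, UniversalEnvelopingAlgebra.lift_ι_apply,
      IsRestrictedModule.toEnd_pMap (φ := φ)]⟩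

/-- A restricted `L`-module `V`, considered as a `u(L)`-module. -/
@[nolint unusedArguments]
def AsModule (φ : PMap F L p) (V : Type*) [AddCommGroup V] [Module F V]
    [LieRingModule L V] [LieModule F L V] [IsRestrictedModule φ V] : Type _ := V

instance : AddCommGroup (AsModule φ V) := inferInstanceAs (AddCommGroup V)

instance : Module φ.Env (AsModule φ V) :=
  Module.compHom V (action φ V).toRingHom

end AsModule

/-- The trivial one-dimensional `L`-module is restricted. -/
instance (φ : PMap F L p) [Fact p.Prime] : IsRestrictedModule φ (TrivialLieModule F L F) where
  toEnd_pMap x := by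
    have h (y : L) : LieModule.toEnd F L (TrivialLieModule F L F) y = 0 := by
      refine LinearMap.ext fun m => ?_
      exact LieModule.IsTrivial.trivial y m
    rw [h, h, zero_pow (Fact.out : p.Prime).ne_zero]

end Restricted

/-! ### Projective covers, Loewy layers, composition multiplicities -/

section Modules

variable (A : Type*) [Ring A] (M : Type*) [AddCommGroup M] [Module A M]

variable {A M} in
/-- `π : P → M` is a projective cover: `P` is projective, `π` is onto, and
`ker π ⊆ Jac(A) P`. -/
structure IsProjectiveCover {P : Type*} [AddCommGroup P] [Module A P] (π : P →ₗ[A] M) : Prop where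
  projective : Module.Projective A P
  surjective : Function.Surjective π
  ker_le : LinearMap.ker π ≤ Ring.jacobson A • (⊤ : Submodule A P)

/-- The `n`-th term `Jac(A)^n M` of the Loewy series of `M`. -/
def loewySeries (n : ℕ) : Submodule A M := Ring.jacobson A ^ n • (⊤ : Submodule A M)

/-- The `n`-th Loewy layer `Jac(A)^(n-1) M / Jac(A)^n M` of `M` (`n ≥ 1`). -/
abbrev LoewyLayer (n : ℕ) : Type _ :=
  ↥(loewySeries A M (n - 1)) ⧸ (loewySeries A M n).submoduleOf (loewySeries A M (n - 1))

variable {A M} in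
/-- The number of factors of the series `s` of submodules that are isomorphic to `S`. -/
def factorCount (s : CompositionSeries (Submodule A M)) (S : Type*) [AddCommGroup S]
    [Module A S] : ℕ :=
  Nat.card {i : Fin s.length //
    Nonempty ((↥(s i.succ) ⧸ (s i.castSucc).submoduleOf (s i.succ)) ≃ₗ[A] S)}

/-- The multiplicity `[M : S]` of `S` as a composition factor of `M`: the number of factors
isomorphic to `S` in a composition series `0 = M₀ ⊂ ⋯ ⊂ Mₙ = M`. By the Jordan–Hölder theorem all
composition series give the same number, so the supremum is their common value. -/
def compositionMultiplicity (S : Type*) [AddCommGroup S] [Module A S] : ℕ∞ :=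
  ⨆ s : {s : CompositionSeries (Submodule A M) // s.head = ⊥ ∧ s.last = ⊤},
    (factorCount s.1 S : ℕ∞)

end Modules

/-! ### Chief series and split abelian chief factors -/

section Chief

variable (F L : Type*) [Field F] [LieRing L] [LieAlgebra F L]

/-- A chief series `0 = L₀ ⊂ L₁ ⊂ ⋯ ⊂ Lₙ = L` of ideals of `L`; `L_j / L_{j-1}` is a minimal
non-zero ideal of `L / L_{j-1}`, that is, `L_{j-1} ⊂ L_j` and no ideal of `L` lies strictly
between. -/
structure ChiefSeries where
  length : ℕ
  ideal : Fin (length + 1) → LieIdeal F L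
  ideal_zero : ideal 0 = ⊥
  ideal_last : ideal (Fin.last length) = ⊤
  covBy : ∀ j : Fin length, ideal j.castSucc ⋖ ideal j.succ

variable {F L}

/-- For ideals `I ⊆ J` of `L`: the `L`-module `J / I`. -/
abbrev ChiefFactor (I J : LieIdeal F L) : Type _ := ↥J ⧸ LieSubmodule.comap (LieSubmodule.incl J) I

/-- For ideals `I ⊆ J` of `L`: the Lie algebra `J / I` is abelian. -/
def IsAbelianFactor (I J : LieIdeal F L) : Prop := ∀ x ∈ J, ∀ y ∈ J, ⁅x, y⁆ ∈ I

/-- For ideals `I ⊆ J` of `L`: the exact sequence `0 → J / I → L / I → L / J → 0` splits in the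
category of Lie algebras, i.e. some Lie algebra homomorphism `σ : L / J → L / I` is a section of the
canonical map `y + I ↦ y + J`. -/
def IsSplitFactor (I J : LieIdeal F L) : Prop :=
  ∃ σ : (L ⧸ J) →ₗ⁅F⁆ (L ⧸ I), ∀ (z : L ⧸ J) (y : L),
    LieSubmodule.Quotient.mk' I y = σ z → LieSubmodule.Quotient.mk' J y = z

/-- The number `[L : S]_split` of the abelian chief factors in the given chief series that are
isomorphic to `S` as `L`-modules and split. -/
def ChiefSeries.splitMultiplicity (c : ChiefSeries F L) (S : Type*) [AddCommGroup S] [Module F S]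
    [LieRingModule L S] : ℕ :=
  Nat.card {j : Fin c.length //
    IsAbelianFactor (c.ideal j.castSucc) (c.ideal j.succ) ∧
    Nonempty (ChiefFactor (c.ideal j.castSucc) (c.ideal j.succ) ≃ₗ⁅F, L⁆ S) ∧
    IsSplitFactor (c.ideal j.castSucc) (c.ideal j.succ)}

end Chief

end RestrictedLie

end

/-! A split abelian chief factor `L_j/L_{j-1} ≅ S` gives a cocycle `D_j : L → S` that vanishes on
`L_{j-1}` but not on `L_j`: take `x` minus a lift of its image under the splitting
(`exists_lieDerivation_of_isSplitFactor`). It defines an extension of the trivial module by `S`,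
which is automatically restricted because `S` is irreducible and non-trivial
(`CocycleExtension.isRestrictedModule`). Lifting `π : P → F` to this extension and taking the
`S`-component gives `f_j : P → S` with `f_j(x q) = x f_j(q) + π(q) D_j(x)`. On `JP` it is linear and
kills `J²P`, so it induces `h_j : JP/J²P → S` (`exists_layer_hom`).

The `h_j` are independent in a triangular sense. Choose `x ∈ L_a` with `D_a(x) ≠ 0` and `q` with
`π(q) = 1`. Since `L_a` annihilates `S`, `h_j` takes the value `D_j(x)` on the class of `x q`; this
is zero for `j > a` because `L_a ⊆ L_{j-1}`, and non-zero for `j = a`. Hence intersecting the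
kernels one at a time produces one factor `S` per good index (`card_le_compositionMultiplicity`).
Composition series exist because `u(L)` is finite-dimensional and `P` is finitely generated. -/

section FiniteDimensional

/-! ### Finite-dimensionality of algebras generated by a Lie algebra with a `p`-map -/

variable {F R ι : Type*} [Field F] [Ring R] [Algebra F R]

theorem Submodule.pow_le_pow_right_of_one_le {W : Submodule F R} (h1 : 1 ≤ W) {m n : ℕ}
    (h : m ≤ n) : W ^ m ≤ W ^ n := by
  induction h with
  | refl => exact le_rfl
  | step _ ih =>
    refine ih.trans fun x hx => ?_
    rw [pow_succ]
    simpa using Submodule.mul_mem_mul hx (Submodule.one_le.mp h1)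

theorem Submodule.list_map_prod_mem_pow {W : Submodule F R} {a : ι → R}
    (ha : ∀ i, a i ∈ W) (l : List ι) : (l.map a).prod ∈ W ^ l.length := by
  induction l with
  | nil => exact Submodule.one_le.mp (pow_zero W).ge
  | cons i l ih =>
    rw [List.map_cons, List.prod_cons, List.length_cons, pow_succ']
    exact Submodule.mul_mem_mul (ha i) ih

/-- If the commutators of the `a i` lie in `W`, then reordering a product of `k + 1` factors changes
it by an element of `W ^ k`. -/
theorem List.Perm.map_prod_sub_mem_pow {W : Submodule F R} (h1 : 1 ≤ W) {a : ι → R}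
    (ha : ∀ i, a i ∈ W) (hc : ∀ i j, a i * a j - a j * a i ∈ W) {l l' : List ι}
    (h : l.Perm l') : ∀ k : ℕ, l.length ≤ k + 1 → (l.map a).prod - (l'.map a).prod ∈ W ^ k := by
  induction h with
  | nil => intro k _; simp
  | @cons x l₁ l₂ hp ih =>
    intro k hk
    rw [List.length_cons] at hk
    rw [List.map_cons, List.map_cons, List.prod_cons, List.prod_cons, ← mul_sub]
    obtain _ | k := k
    · obtain rfl : l₁ = [] := List.length_eq_zero_iff.mp (by omega)
      obtain rfl := hp.nil_eq
      simp
    · rw [pow_succ']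
      exact Submodule.mul_mem_mul (ha x) (ih k (by omega))
  -- The difference is a commutator times the remaining word; the commutator counts as one factor
  -- from `W`, so one factor is saved.
  | swap x y l =>
    intro k hk
    simp only [List.map_cons, List.prod_cons, List.length_cons, ← mul_assoc, ← sub_mul] at hk ⊢
    refine Submodule.pow_le_pow_right_of_one_le h1 (m := l.length + 1) (by omega) ?_
    rw [pow_succ']
    exact Submodule.mul_mem_mul (hc y x) (Submodule.list_map_prod_mem_pow ha l)
  | trans h₁ _ ih₁ ih₂ =>
    intro k hk
    have := add_mem (ih₁ k hk) (ih₂ k (h₁.length_eq ▸ hk))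
    rwa [sub_add_sub_cancel] at this

/-- Pigeonhole: if each of the `n` letters occurred at most `p - 1` times, the word would have
length at most `n * (p - 1)`. -/
theorem List.exists_le_count {n p : ℕ} (l : List (Fin n)) (h : n * (p - 1) < l.length) :
    ∃ i, p ≤ l.count i := by
  by_contra! hl
  have h2 : ∑ i : Fin n, l.count i = l.length := by
    simpa using Multiset.sum_count_eq_card (s := Finset.univ) (m := (l : Multiset (Fin n)))
      (fun _ _ => Finset.mem_univ _)
  have h3 : ∑ i : Fin n, l.count i ≤ ∑ _i : Fin n, (p - 1) :=
    Finset.sum_le_sum fun i _ => by have := hl i; omega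
  simp at h3
  omega

open scoped Pointwise in
theorem Submodule.exists_list_of_mem_insert_pow {a : ι → R} {k : ℕ} {x : R}
    (hx : x ∈ insert 1 (Set.range a) ^ k) : ∃ l : List ι, l.length ≤ k ∧ (l.map a).prod = x := by
  induction k generalizing x with
  | zero => exact ⟨[], by simp, by simpa [eq_comm] using hx⟩
  | succ k ih =>
    rw [pow_succ'] at hx
    obtain ⟨s, hs, y, hy, rfl⟩ := Set.mem_mul.mp hx
    obtain ⟨l, hl, rfl⟩ := ih hy
    obtain rfl | ⟨i, rfl⟩ := hs
    · exact ⟨l, by omega, by simp⟩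
    · exact ⟨i :: l, by simpa using hl, by simp⟩

/-- An algebra generated by the image of a finite-dimensional Lie algebra `L` under a map
`f` that respects brackets is finite-dimensional if `f x ^ p ∈ f(L)` for all `x`. -/
theorem Module.Finite.of_lie_generators {L : Type*} [LieRing L] [LieAlgebra F L]
    [Module.Finite F L] {p : ℕ} (hp : 2 ≤ p) (f : L →ₗ[F] R)
    (hf : ∀ x y, f ⁅x, y⁆ = f x * f y - f y * f x) (hpow : ∀ x, ∃ y, f x ^ p = f y)
    (htop : Algebra.adjoin F (Set.range f) = ⊤) : Module.Finite F R := by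
  let b := Module.finBasis F L
  let a : Fin (Module.finrank F L) → R := fun i => f (b i)
  let W : Submodule F R := Submodule.span F (insert 1 (Set.range a))
  have h1 : 1 ≤ W := Submodule.one_le.mpr (Submodule.subset_span (Set.mem_insert _ _))
  have hfW : ∀ x, f x ∈ W := by
    intro x
    rw [← b.sum_repr x, map_sum]
    refine sum_mem fun i _ => ?_
    rw [map_smul]
    exact W.smul_mem _ (Submodule.subset_span (Set.mem_insert_of_mem _ ⟨i, rfl⟩))
  have ha : ∀ i, a i ∈ W := fun i => hfW _
  have hc : ∀ i j, a i * a j - a j * a i ∈ W := fun i j => hf (b i) (b j) ▸ hfW _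
  -- The spanning half of Poincaré–Birkhoff–Witt for `u(L)`: in a word of length `k + 1` some
  -- generator occurs `p` times; modulo shorter words these copies can be collected at the front and
  -- replaced by a single element of `f(L)`.
  have step : ∀ k, Module.finrank F L * (p - 1) ≤ k → W ^ (k + 1) ≤ W ^ k := by
    intro k hk
    rw [Submodule.span_pow, Submodule.span_le]
    intro x hx
    obtain ⟨l, hl, rfl⟩ := Submodule.exists_list_of_mem_insert_pow hx
    obtain hlt | hge := Nat.lt_or_ge l.length (k + 1)
    · exact Submodule.pow_le_pow_right_of_one_le h1 (Nat.lt_succ_iff.mp hlt)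
        (Submodule.list_map_prod_mem_pow ha l)
    obtain ⟨i, hi⟩ := l.exists_le_count (p := p) (by omega)
    obtain ⟨l', hl'⟩ := (List.replicate_sublist_iff.mpr hi).exists_perm_append
    have hlen := hl'.length_eq
    rw [List.length_append, List.length_replicate] at hlen
    have h2 : ((List.replicate p i ++ l').map a).prod ∈ W ^ k := by
      obtain ⟨y, hy⟩ := hpow (b i)
      have : ((List.replicate p i ++ l').map a).prod = f y * (l'.map a).prod := by
        simp [a, hy]
      rw [this]
      -- Here `2 ≤ p` matters: replacing `p` factors by one shortens the word.
      refine Submodule.pow_le_pow_right_of_one_le h1 (m := l'.length + 1) (by omega) ?_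
      rw [pow_succ']
      exact Submodule.mul_mem_mul (hfW y) (Submodule.list_map_prod_mem_pow ha l')
    have := add_mem (hl'.map_prod_sub_mem_pow h1 ha hc k hl) h2
    rwa [sub_add_cancel] at this
  set N := Module.finrank F L * (p - 1) with hN
  have hle : ∀ m, W ^ (N + m) ≤ W ^ N := by
    intro m
    induction m with
    | zero => exact le_rfl
    | succ m ih => exact (step (N + m) (by omega)).trans ih
  -- `W ^ (N + 1)` is closed under products, as `W ^ (2 * N + 2) ≤ W ^ N`. The exponent is `N + 1`
  -- so that `W` is contained in it even when `N = 0`.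
  have hadj : Algebra.adjoin F (Set.range f) ≤
      Submodule.toSubalgebra (W ^ (N + 1)) (Submodule.pow_le_pow_right_of_one_le h1
        (Nat.zero_le _) (Submodule.one_le.mp (pow_zero W).ge)) (fun x y hx hy => by
          refine Submodule.pow_le_pow_right_of_one_le h1 (Nat.le_succ N) (hle (N + 2) ?_)
          have := Submodule.mul_mem_mul hx hy
          rw [← pow_add] at this
          convert! this using 2
          omega) := by
    rw [Algebra.adjoin_le_iff]
    rintro _ ⟨x, rfl⟩
    exact Submodule.pow_le_pow_right_of_one_le h1 (m := 1) (by omega) (by simpa using hfW x)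
  have hWtop : W ^ (N + 1) = ⊤ := by
    rw [htop] at hadj
    exact eq_top_iff.mpr fun x _ => hadj (Algebra.mem_top (x := x))
  refine ⟨hWtop ▸ Submodule.FG.pow ?_ _⟩
  exact Submodule.fg_span ((Set.finite_range a).insert 1)

end FiniteDimensional

namespace RestrictedLie

attribute [local instance] LieRing.ofAssociativeRing

/-! ### Generators of `u(L)` and the passage from restricted modules to `u(L)`-modules -/

section Env

variable {F L : Type*} [Field F] [LieRing L] [LieAlgebra F L] {p : ℕ} (φ : PMap F L p)

/-- The canonical map `L → u(L)`. -/
noncomputable def PMap.ι : L →ₗ[F] φ.Env :=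
  (RingQuot.mkAlgHom F φ.Rel).toLinearMap ∘ₗ
    (UniversalEnvelopingAlgebra.ι F : L →ₗ⁅F⁆ UniversalEnvelopingAlgebra F L).toLinearMap

theorem PMap.ι_apply (x : L) :
    φ.ι x = RingQuot.mkAlgHom F φ.Rel (UniversalEnvelopingAlgebra.ι F x) := rfl

theorem PMap.ι_lie (x y : L) : φ.ι ⁅x, y⁆ = φ.ι x * φ.ι y - φ.ι y * φ.ι x := by
  simp only [PMap.ι_apply]
  rw [LieHom.map_lie, LieRing.of_associative_ring_bracket, map_sub, map_mul, map_mul]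

theorem PMap.ι_pow (x : L) : φ.ι x ^ p = φ.ι (φ.toFun x) := by
  simp only [PMap.ι_apply]
  rw [← map_pow]
  exact RingQuot.mkAlgHom_rel F (PMap.Rel.pow x)

theorem PMap.adjoin_range_ι : Algebra.adjoin F (Set.range φ.ι) = ⊤ := by
  have h : Function.Surjective ((RingQuot.mkAlgHom F φ.Rel).comp
      (UniversalEnvelopingAlgebra.mkAlgHom F L)) :=
    (RingQuot.mkAlgHom_surjective F φ.Rel).comp
      (RingCon.mkₐ_surjective (α := F) (UniversalEnvelopingAlgebra.ringCon F L))
  rw [← AlgHom.range_eq_top] at h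
  rw [← h, ← Algebra.map_top, ← TensorAlgebra.adjoin_range_ι, AlgHom.map_adjoin, ← Set.range_comp]
  rfl

theorem PMap.env_finite [Module.Finite F L] (hp : 2 ≤ p) : Module.Finite F φ.Env :=
  Module.Finite.of_lie_generators hp φ.ι φ.ι_lie (fun x => ⟨_, φ.ι_pow x⟩) φ.adjoin_range_ι

variable (V : Type*) [AddCommGroup V] [Module F V] [LieRingModule L V] [LieModule F L V]
  [IsRestrictedModule φ V]

/-- The identity map from a restricted module to the associated `u(L)`-module. -/
def AsModule.of : V ≃+ AsModule φ V := AddEquiv.refl V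

variable {V}

theorem AsModule.smul_of (a : φ.Env) (v : V) : a • of φ V v = of φ V (action φ V a v) := rfl

theorem action_ι (x : L) : action φ V (φ.ι x) = LieModule.toEnd F L V x := by
  rw [PMap.ι_apply, action, RingQuot.liftAlgHom_mkAlgHom_apply,
    UniversalEnvelopingAlgebra.lift_ι_apply]

theorem AsModule.ι_smul_of (x : L) (v : V) : φ.ι x • of φ V v = of φ V ⁅x, v⁆ := by
  rw [smul_of, action_ι, LieModule.toEnd_apply_apply]

theorem AsModule.algebraMap_smul_of (c : F) (v : V) :
    algebraMap F φ.Env c • of φ V v = of φ V (c • v) := by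
  rw [smul_of, AlgHom.commutes, Module.algebraMap_end_apply]

/-- Induction over `u(L)`, which is generated by `L` as an `F`-algebra. -/
theorem PMap.env_induction {C : φ.Env → Prop} (hc : ∀ c : F, C (algebraMap F φ.Env c))
    (hι : ∀ x, C (φ.ι x)) (hadd : ∀ a b, C a → C b → C (a + b))
    (hmul : ∀ a b, C a → C b → C (a * b)) (a : φ.Env) : C a := by
  have ha : a ∈ Algebra.adjoin F (Set.range φ.ι) := φ.adjoin_range_ι ▸ Algebra.mem_top
  induction ha using Algebra.adjoin_induction with
  | mem x hx => obtain ⟨x, rfl⟩ := hx; exact hι x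
  | algebraMap r => exact hc r
  | add x y _ _ hx hy => exact hadd x y hx hy
  | mul x y _ _ hx hy => exact hmul x y hx hy

theorem AsModule.isSimpleModule (h : LieModule.IsIrreducible F L V) :
    IsSimpleModule φ.Env (AsModule φ V) := by
  have hnt : Nontrivial V := (LieSubmodule.nontrivial_iff F L V).mp h.toNontrivial
  have : Nontrivial (AsModule φ V) := hnt
  refine { toIsSimpleOrder := { eq_bot_or_eq_top := fun N => ?_ } }
  let N' : LieSubmodule F L V :=
    { carrier := {v | of φ V v ∈ N}
      add_mem' := fun ha hb => N.add_mem ha hb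
      zero_mem' := N.zero_mem
      smul_mem' := fun c v hv => by
        change of φ V (c • v) ∈ N
        rw [← algebraMap_smul_of]
        exact N.smul_mem _ hv
      lie_mem := fun {x v} hv => by
        change of φ V ⁅x, v⁆ ∈ N
        rw [← ι_smul_of]
        exact N.smul_mem _ hv }
  have hN : ∀ v, v ∈ N' ↔ of φ V v ∈ N := fun v => Iff.rfl
  refine (eq_bot_or_eq_top N').imp (fun hb => ?_) (fun ht => ?_)
  · exact (Submodule.eq_bot_iff N).mpr fun v hv => by
      have : v ∈ N' := hv
      rw [hb] at this
      exact this
  · refine eq_top_iff.mpr fun v _ => ?_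
    have : v ∈ N' := by rw [ht]; exact LieSubmodule.mem_top (R := F) (L := L) (M := V) _
    exact this

end Env

/-! ### Extensions of the trivial module by cocycles -/

section Cocycle

variable {F L S : Type*} [Field F] [LieRing L] [LieAlgebra F L]
  [AddCommGroup S] [Module F S] [LieRingModule L S] [LieModule F L S]

/-- The extension of the trivial module by `S` given by a `1`-cocycle `D : L → S`. -/
@[nolint unusedArguments]
def CocycleExtension (_D : LieDerivation F L S) : Type _ := S × F

namespace CocycleExtension

variable (D : LieDerivation F L S)

instance : AddCommGroup (CocycleExtension D) := inferInstanceAs (AddCommGroup (S × F))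

instance : Module F (CocycleExtension D) := inferInstanceAs (Module F (S × F))

/-- The projection to `S`, as a linear map. -/
def fst : CocycleExtension D →ₗ[F] S := LinearMap.fst F S F

/-- The projection to the trivial module, as a linear map. -/
def snd : CocycleExtension D →ₗ[F] F := LinearMap.snd F S F

/-- The element with the given components. -/
def mk (s : S) (c : F) : CocycleExtension D := (s, c)

variable {D} in
@[ext]
theorem ext {u v : CocycleExtension D} (h₁ : fst D u = fst D v) (h₂ : snd D u = snd D v) : u = v :=
  Prod.ext h₁ h₂

@[simp]
theorem fst_mk (s : S) (c : F) : fst D (mk D s c) = s := rfl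

@[simp]
theorem snd_mk (s : S) (c : F) : snd D (mk D s c) = c := rfl

instance : Bracket L (CocycleExtension D) := ⟨fun x u => mk D (⁅x, fst D u⁆ + snd D u • D x) 0⟩

@[simp]
theorem fst_lie (x : L) (u : CocycleExtension D) :
    fst D ⁅x, u⁆ = ⁅x, fst D u⁆ + snd D u • D x := rfl

@[simp]
theorem snd_lie (x : L) (u : CocycleExtension D) : snd D ⁅x, u⁆ = 0 := rfl

instance : LieRingModule L (CocycleExtension D) where
  add_lie x y u := by
    ext
    · simp only [fst_lie, add_lie, map_add, smul_add]; abel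
    · simp
  lie_add x u v := by
    ext
    · simp only [fst_lie, map_add, lie_add, add_smul]; abel
    · simp
  leibniz_lie x y u := by
    ext
    · simp only [fst_lie, snd_lie, map_add, LieDerivation.apply_lie_eq_sub, smul_sub, lie_add,
        lie_smul, zero_smul, lie_lie]
      abel
    · simp

instance : LieModule F L (CocycleExtension D) where
  smul_lie c x u := by
    ext
    · simp only [fst_lie, map_smul, smul_lie, smul_add, smul_comm c (snd D u)]
    · simp
  lie_smul c x u := by
    ext
    · simp only [fst_lie, map_smul, lie_smul, smul_add, smul_assoc]
    · simp

end CocycleExtension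

/-- In characteristic `p`, the operator `ρ(x) ^ p - ρ(x^[p])` on a representation of `L` commutes
with `L`. -/
theorem PMap.toEnd_pow_sub_commute {p : ℕ} [Fact p.Prime] [CharP F p] (φ : PMap F L p)
    {V : Type*} [AddCommGroup V] [Module F V] [LieRingModule L V] [LieModule F L V] (x y : L) :
    Commute (LieModule.toEnd F L V x ^ p - LieModule.toEnd F L V (φ.toFun x))
      (LieModule.toEnd F L V y) := by
  obtain _ | _ := subsingleton_or_nontrivial V
  · exact Subsingleton.elim _ _
  set ρ := LieModule.toEnd F L V
  have : CharP (Module.End F (Module.End F V)) p := charP_of_injective_algebraMap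
    (FaithfulSMul.algebraMap_injective F (Module.End F (Module.End F V))) p
  have h1 : ∀ n : ℕ, ρ ((LieAlgebra.ad F L x ^ n) y) =
      (LieAlgebra.ad F (Module.End F V) (ρ x) ^ n) (ρ y) := by
    intro n
    induction n with
    | zero => rfl
    | succ n ih =>
      rw [pow_succ', pow_succ', Module.End.mul_apply, Module.End.mul_apply, LieAlgebra.ad_apply,
        LieAlgebra.ad_apply, LieHom.map_lie, ih]
  have h2 := h1 p
  -- `ad ρ(x)` is the difference of the commuting operators of left and right multiplication by
  -- `ρ(x)`, so in characteristic `p` its `p`-th power is `ad (ρ(x) ^ p)`.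
  rw [← φ.ad', LieAlgebra.ad_apply, LieHom.map_lie, LieAlgebra.ad_eq_lmul_left_sub_lmul_right,
    Pi.sub_apply, sub_pow_expChar_of_commute _ (LinearMap.commute_mulLeft_right (R := F) _ _),
    LinearMap.pow_mulLeft, LinearMap.pow_mulRight, LinearMap.sub_apply, LinearMap.mulLeft_apply,
    LinearMap.mulRight_apply, LieRing.of_associative_ring_bracket] at h2
  rw [commute_iff_eq, sub_mul, mul_sub, sub_eq_sub_iff_sub_eq_sub]
  exact h2.symm

/-- The invariants form a submodule, which cannot be everything. This is where non-triviality of `S`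
enters. -/
theorem eq_zero_of_forall_lie_eq_zero (hS : LieModule.IsIrreducible F L S)
    (hS' : ¬ LieModule.IsTrivial L S) {s : S} (hs : ∀ x : L, ⁅x, s⁆ = 0) : s = 0 := by
  have hs' : s ∈ LieModule.maxTrivSubmodule F L S := hs
  obtain h | h := eq_bot_or_eq_top (LieModule.maxTrivSubmodule F L S)
  · simpa [h] using hs'
  · exact absurd ((LieModule.isTrivial_iff_max_triv_eq_top F L S).mpr h) hS'

/-- The defect `T = ρ(x) ^ p - ρ(x^[p])` commutes with `L`, kills `S` because `S` is restricted, and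
has image in `S`. Since `L` maps the extension into `S`, `y T(u) = T(y u) = 0` for all `y`, so
`T(u)` is an invariant of `S` and hence zero. -/
theorem CocycleExtension.isRestrictedModule {p : ℕ} [Fact p.Prime] [CharP F p] (φ : PMap F L p)
    [IsRestrictedModule φ S] (hS : LieModule.IsIrreducible F L S)
    (hS' : ¬ LieModule.IsTrivial L S) (D : LieDerivation F L S) :
    IsRestrictedModule φ (CocycleExtension D) where
  toEnd_pMap x := by
    set T := LieModule.toEnd F L (CocycleExtension D) x ^ p -
      LieModule.toEnd F L (CocycleExtension D) (φ.toFun x) with hT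
    have hsub : ∀ (n : ℕ) (s : S), (LieModule.toEnd F L (CocycleExtension D) x ^ n) (mk D s 0) =
        mk D ((LieModule.toEnd F L S x ^ n) s) 0 := by
      intro n s
      induction n with
      | zero => rfl
      | succ n ih =>
        rw [pow_succ', pow_succ', Module.End.mul_apply, Module.End.mul_apply, ih]
        ext <;> simp
    have hTS : ∀ s : S, T (mk D s 0) = 0 := by
      intro s
      rw [hT, LinearMap.sub_apply, hsub, ← IsRestrictedModule.toEnd_pMap (φ := φ), sub_eq_zero]
      ext <;> simp
    have hsnd : ∀ u, snd D (T u) = 0 := by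
      intro u
      obtain ⟨k, hk⟩ := Nat.exists_eq_succ_of_ne_zero (Fact.out : p.Prime).ne_zero
      have hpow : LieModule.toEnd F L (CocycleExtension D) x ^ p =
          LieModule.toEnd F L (CocycleExtension D) x *
            LieModule.toEnd F L (CocycleExtension D) x ^ k := by
        rw [← pow_succ', ← Nat.succ_eq_add_one, ← hk]
      rw [hT, hpow, LinearMap.sub_apply, Module.End.mul_apply, map_sub,
        LieModule.toEnd_apply_apply, LieModule.toEnd_apply_apply, snd_lie, snd_lie, sub_self]
    have hT0 : ∀ u, T u = 0 := by
      intro u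
      ext
      · rw [map_zero]
        refine eq_zero_of_forall_lie_eq_zero hS hS' fun y => ?_
        have h := LinearMap.congr_fun (φ.toEnd_pow_sub_commute (V := CocycleExtension D) x y).eq u
        rw [Module.End.mul_apply, Module.End.mul_apply, ← hT, LieModule.toEnd_apply_apply,
          LieModule.toEnd_apply_apply] at h
        have h3 : T ⁅y, u⁆ = 0 := hTS _
        have h5 := congrArg (fst D) (h.symm.trans h3)
        rwa [fst_lie, hsnd, zero_smul, add_zero, map_zero] at h5
      · rw [hsnd, map_zero]
    exact (sub_eq_zero.mp (LinearMap.ext hT0 : T = 0)).symm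

end Cocycle

/-! ### Lower bounds for multiplicities from maps to a simple module -/

section Multiplicity

variable {A M S ι : Type*} [Ring A] [AddCommGroup M] [Module A M] [AddCommGroup S] [Module A S]

theorem factorCount_add_one_le_factorCount_snoc (s : CompositionSeries (Submodule A M))
    (N : Submodule A M) (h : JordanHolderLattice.IsMaximal s.last N)
    (e : Nonempty ((N ⧸ s.last.submoduleOf N) ≃ₗ[A] S)) :
    factorCount s S + 1 ≤ factorCount (s.snoc N h) S := by
  classical
  let t : Fin (s.length + 1 + 1) → Submodule A M := (s.snoc N h).toFun
  have ht : ∀ i, t (Fin.castSucc i) = s i := RelSeries.snoc_castSucc s N h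
  have ht' : t (Fin.last _) = N := RelSeries.last_snoc' s N h
  let Q : Submodule A M → Submodule A M → Prop :=
    fun U V => Nonempty ((V ⧸ U.submoduleOf V) ≃ₗ[A] S)
  have h1 : ∀ i : Fin s.length, Q (s i.castSucc) (s i.succ) →
      Q (t (Fin.castSucc i.castSucc)) (t (Fin.succ i.castSucc)) := by
    intro i hi
    rwa [Fin.succ_castSucc, ht, ht]
  have h2 : Q (t (Fin.castSucc (Fin.last s.length))) (t (Fin.succ (Fin.last s.length))) := by
    rw [Fin.succ_last, ht, ht']
    exact e
  let f : Option {i : Fin s.length // Q (s i.castSucc) (s i.succ)} →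
      {i : Fin (s.length + 1) // Q (t i.castSucc) (t i.succ)} :=
    fun o => o.elim ⟨Fin.last _, h2⟩ fun i => ⟨i.1.castSucc, h1 i.1 i.2⟩
  have hf : Function.Injective f := by
    rintro (_ | i) (_ | j) hij
    · rfl
    · exact absurd (congrArg Subtype.val hij).symm (Fin.castSucc_lt_last _).ne
    · exact absurd (congrArg Subtype.val hij) (Fin.castSucc_lt_last _).ne
    · exact congrArg some (Subtype.ext (Fin.castSucc_injective _ (congrArg Subtype.val hij)))
  have := Nat.card_le_card_of_injective f hf
  rwa [Finite.card_option] at this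

theorem LinearMap.nonempty_quotient_ker_inf_equiv [IsSimpleModule A S] (f : M →ₗ[A] S)
    {N : Submodule A M} (h : ¬ N ≤ LinearMap.ker f) :
    Nonempty ((N ⧸ (LinearMap.ker f ⊓ N).submoduleOf N) ≃ₗ[A] S) := by
  have hne : f.domRestrict N ≠ 0 := fun h0 => h fun x hx => LinearMap.congr_fun h0 ⟨x, hx⟩
  have hker : (LinearMap.ker f ⊓ N).submoduleOf N = LinearMap.ker (f.domRestrict N) := by
    ext x
    simp [Submodule.submoduleOf]
  exact ⟨(Submodule.quotEquivOfEq _ _ hker).trans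
    ((f.domRestrict N).quotKerEquivOfSurjective (LinearMap.surjective_of_ne_zero hne))⟩

/-- A series ending at the common kernel is continued upwards by dropping the smallest index first.
By the hypothesis on the later maps, `h a` restricts to a non-zero, hence surjective, map on the
next intersection, so each step adds a factor `S`. -/
theorem exists_compositionSeries_factorCount [IsSimpleModule A S] [LinearOrder ι]
    (h : ι → M →ₗ[A] S) (T : Finset ι)
    (hT : ∀ a ∈ T, ∀ G ⊆ T, (∀ i ∈ G, a < i) →
      ¬ (G.inf fun i => LinearMap.ker (h i)) ≤ LinearMap.ker (h a)) :
    ∀ s : CompositionSeries (Submodule A M), s.head = ⊥ →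
      s.last = (T.inf fun i => LinearMap.ker (h i)) →
      ∃ t : CompositionSeries (Submodule A M), t.head = ⊥ ∧ t.last = ⊤ ∧
        factorCount s S + T.card ≤ factorCount t S := by
  classical
  induction T using Finset.induction_on_min with
  | empty => exact fun s hs hl => ⟨s, hs, by simpa using hl, by simp⟩
  | insert a G hG ih =>
    intro s hs hl
    have haG : a ∉ G := fun h => lt_irrefl _ (hG a h)
    rw [Finset.inf_insert] at hl
    have hn := hT a (Finset.mem_insert_self _ _) G (Finset.subset_insert _ _) hG
    obtain ⟨e⟩ := LinearMap.nonempty_quotient_ker_inf_equiv (h a) hn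
    rw [← hl] at e
    have hcov : s.last ⋖ G.inf fun i => LinearMap.ker (h i) := by
      rw [covBy_iff_quot_is_simple (hl.le.trans inf_le_right)]
      exact IsSimpleModule.congr e
    obtain ⟨t, ht, ht', hc⟩ := ih (fun b hb G' hG' => hT b (Finset.mem_insert_of_mem hb) G'
      (hG'.trans (Finset.subset_insert _ _))) (s.snoc _ hcov) (by simpa using hs) (by simp)
    refine ⟨t, ht, ht', ?_⟩
    have := factorCount_add_one_le_factorCount_snoc s _ hcov ⟨e⟩
    rw [Finset.card_insert_of_notMem haG]
    omega

/-- A finite family of maps to a simple module `S`, none of which vanishes on the common kernel of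
the later ones, bounds the multiplicity of `S` from below. -/
theorem card_le_compositionMultiplicity [IsNoetherian A M] [IsArtinian A M] [IsSimpleModule A S]
    [LinearOrder ι] (h : ι → M →ₗ[A] S) (T : Finset ι)
    (hT : ∀ a ∈ T, ∀ G ⊆ T, (∀ i ∈ G, a < i) →
      ¬ (G.inf fun i => LinearMap.ker (h i)) ≤ LinearMap.ker (h a)) :
    (T.card : ℕ∞) ≤ compositionMultiplicity A M S := by
  obtain ⟨f, f0, n, hn, hf⟩ := exists_covBy_seq_of_wellFoundedLT_wellFoundedGT_of_le
    (bot_le (a := T.inf fun i => LinearMap.ker (h i)))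
  obtain ⟨t, ht, ht', hc⟩ := exists_compositionSeries_factorCount h T hT
    ⟨n, fun i => f i, fun i => hf i i.2⟩ f0 hn
  calc (T.card : ℕ∞) ≤ (factorCount t S : ℕ∞) := by exact_mod_cast (Nat.le_add_left _ _).trans hc
    _ ≤ _ := le_iSup (fun s : {s : CompositionSeries (Submodule A M) // s.head = ⊥ ∧ s.last = ⊤} =>
        (factorCount s.1 S : ℕ∞)) ⟨t, ht, ht'⟩

/-- `f` factors through the image of `M` in the finite power `S ^ G`; that power is semisimple, so
the factored map extends to all of it, and its components are the coefficients. -/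
theorem exists_eq_sum_of_inf_ker_le [IsSemisimpleModule A S] (h : ι → M →ₗ[A] S) (f : M →ₗ[A] S)
    (G : Finset ι) (hG : (G.inf fun i => LinearMap.ker (h i)) ≤ LinearMap.ker f) :
    ∃ d : ι → Module.End A S, ∀ m, f m = ∑ i ∈ G, d i (h i m) := by
  classical
  let H : M →ₗ[A] (G → S) := LinearMap.pi fun i => h i
  have hker : LinearMap.ker H ≤ LinearMap.ker f := by
    refine le_trans (fun m hm => ?_) hG
    rw [Submodule.mem_finsetInf]
    exact fun i hi => congrFun (hm : H m = 0) ⟨i, hi⟩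
  obtain ⟨ψ, hψ⟩ := IsSemisimpleModule.extension_property ((LinearMap.ker H).liftQ H le_rfl)
    (LinearMap.ker_eq_bot.mp (Submodule.ker_liftQ_eq_bot _ _ _ le_rfl))
    ((LinearMap.ker H).liftQ f hker)
  refine ⟨fun i => if hi : i ∈ G then ψ ∘ₗ LinearMap.single A (fun _ : G => S) ⟨i, hi⟩ else 0,
    fun m => ?_⟩
  have h1 : f m = ψ (H m) := (LinearMap.congr_fun hψ (Submodule.Quotient.mk m)).symm
  rw [h1, ← Finset.univ_sum_single (H m), map_sum, ← Finset.sum_coe_sort G]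
  refine Finset.sum_congr rfl fun i _ => ?_
  beta_reduce
  rw [dif_pos i.2]
  rfl

end Multiplicity

/-! ### Cocycles from split abelian chief factors -/

section Chief

variable {F L S : Type*} [Field F] [LieRing L] [LieAlgebra F L]
  [AddCommGroup S] [Module F S] [LieRingModule L S] [LieModule F L S]

theorem ChiefSeries.monotone_ideal (c : ChiefSeries F L) : Monotone c.ideal :=
  Fin.monotone_iff_le_succ.mpr fun j => (c.covBy j).le

/-- A splitting of an abelian factor `J / I ≅ S` of `L` yields a cocycle `L → S` that
restricts to the given map `J → S`. -/
theorem exists_lieDerivation_of_isSplitFactor {I J : LieIdeal F L}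
    (hab : IsAbelianFactor I J) (hsplit : IsSplitFactor I J) (q : J →ₗ⁅F, L⁆ S)
    (hq : ∀ z : J, (z : L) ∈ I → q z = 0) :
    ∃ D : LieDerivation F L S, ∀ z : J, D z = q z := by
  obtain ⟨σ, hσ⟩ := hsplit
  -- `y x` is a representative in `L` of `σ(x + J)`; the cocycle is `x ↦ q (x - y x)`. The choice of
  -- `y` is not linear, but its defects lie in `I`, where `q` vanishes.
  have hex : ∀ x : L, ∃ y : L, x - y ∈ J ∧
      LieSubmodule.Quotient.mk' I y = σ (LieSubmodule.Quotient.mk' J x) := by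
    intro x
    obtain ⟨y, hy⟩ := LieSubmodule.Quotient.surjective_mk' I (σ (LieSubmodule.Quotient.mk' J x))
    refine ⟨y, ?_, hy⟩
    have := hσ _ _ hy
    rw [← LieSubmodule.Quotient.mk_eq_zero, map_sub, this, sub_self]
  choose y hyJ hy using hex
  have hq' : ∀ (u v : L) (hu : u ∈ J) (hv : v ∈ J), u - v ∈ I → q ⟨u, hu⟩ = q ⟨v, hv⟩ := by
    intro u v hu hv huv
    rw [← sub_eq_zero, ← map_sub]
    exact hq _ huv
  have hmem : ∀ u v : L, LieSubmodule.Quotient.mk' I u = LieSubmodule.Quotient.mk' I v →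
      u - v ∈ I := by
    intro u v huv
    rw [← LieSubmodule.Quotient.mk_eq_zero, map_sub, huv, sub_self]
  refine ⟨{ toFun := fun x => q ⟨x - y x, hyJ x⟩, map_add' := ?_, map_smul' := ?_, leibniz' := ?_ },
    ?_⟩
  · intro u v
    rw [← map_add]
    refine hq' _ _ _ _ ?_
    have : u + v - y (u + v) - (u - y u + (v - y v)) = y u + y v - y (u + v) := by abel
    change u + v - y (u + v) - (u - y u + (v - y v)) ∈ I
    rw [this]
    exact hmem _ _ (by rw [map_add, hy, hy, hy, map_add, map_add])
  · intro a u
    rw [RingHom.id_apply, ← map_smul]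
    refine hq' _ _ _ _ ?_
    have : a • u - y (a • u) - a • (u - y u) = a • y u - y (a • u) := by rw [smul_sub]; abel
    change a • u - y (a • u) - a • (u - y u) ∈ I
    rw [this]
    exact hmem _ _ (by rw [map_smul, hy, hy, map_smul, map_smul])
  · intro u v
    change q ⟨⁅u, v⁆ - y ⁅u, v⁆, _⟩ = ⁅u, q ⟨v - y v, _⟩⁆ - ⁅v, q ⟨u - y u, _⟩⁆
    rw [← LieModuleHom.map_lie, ← LieModuleHom.map_lie, ← map_sub]
    refine hq' _ _ _ _ ?_
    change ⁅u, v⁆ - y ⁅u, v⁆ - (⁅u, v - y v⁆ - ⁅v, u - y u⁆) ∈ I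
    have h1 : ⁅y u, y v⁆ - y ⁅u, v⁆ ∈ I := by
      refine hmem _ _ ?_
      have h2 : ∀ a b : L, LieSubmodule.Quotient.mk' I ⁅a, b⁆ =
        ⁅LieSubmodule.Quotient.mk' I a, LieSubmodule.Quotient.mk' I b⁆ := fun a b => rfl
      have h3 : LieSubmodule.Quotient.mk' J ⁅u, v⁆ =
        ⁅LieSubmodule.Quotient.mk' J u, LieSubmodule.Quotient.mk' J v⁆ := rfl
      rw [h2, hy, hy, hy, h3, LieHom.map_lie]
    have h4 := hab _ (hyJ u) _ (hyJ v)
    -- The first term on the right lies in `I` because `σ` preserves brackets, the second because `J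
    -- / I` is abelian.
    have : ⁅u, v⁆ - y ⁅u, v⁆ - (⁅u, v - y v⁆ - ⁅v, u - y u⁆) =
        (⁅y u, y v⁆ - y ⁅u, v⁆) - ⁅u - y u, v - y v⁆ := by
      simp only [lie_sub, sub_lie]
      rw [← lie_skew v u, ← lie_skew v (y u)]
      abel
    rw [this]
    exact sub_mem h1 h4
  · intro z
    refine hq' _ _ _ _ ?_
    have : (z : L) - y z - z = -(y z) := by abel
    rw [this]
    refine neg_mem ?_
    have h0 : LieSubmodule.Quotient.mk' J (z : L) = 0 :=
      LieSubmodule.Quotient.mk_eq_zero'.mpr z.2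
    rw [← LieSubmodule.Quotient.mk_eq_zero, hy, h0, map_zero]

/-- An abelian split chief factor `J / I ≅ S` yields a cocycle `L → S` that vanishes on `I`, but
not on `J`; and `J` annihilates `S`. -/
theorem exists_lieDerivation_of_chiefFactor [Nontrivial S] {I J : LieIdeal F L} (hIJ : I ≤ J)
    (hab : IsAbelianFactor I J) (e : ChiefFactor I J ≃ₗ⁅F, L⁆ S) (hsplit : IsSplitFactor I J) :
    ∃ D : LieDerivation F L S, (∀ x ∈ I, D x = 0) ∧ ∃ x ∈ J, D x ≠ 0 ∧ ∀ s : S, ⁅x, s⁆ = 0 := by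
  let q : J →ₗ⁅F, L⁆ S := e.toLieModuleHom.comp (LieSubmodule.Quotient.mk' _)
  have hq : ∀ z : J, (z : L) ∈ I → q z = 0 := by
    intro z hz
    have : LieSubmodule.Quotient.mk' (LieSubmodule.comap (LieSubmodule.incl J) I) z = 0 :=
      (LieSubmodule.Quotient.mk_eq_zero (N := LieSubmodule.comap (LieSubmodule.incl J) I)).mpr hz
    change e (LieSubmodule.Quotient.mk' _ z) = 0
    rw [this]
    exact map_zero e.toLieModuleHom
  have hsurj : Function.Surjective q :=
    e.surjective.comp (LieSubmodule.Quotient.surjective_mk' _)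
  obtain ⟨D, hD⟩ := exists_lieDerivation_of_isSplitFactor hab hsplit q hq
  refine ⟨D, fun x hx => (hD ⟨x, hIJ hx⟩).trans (hq _ hx), ?_⟩
  obtain ⟨s, hs⟩ := exists_ne (0 : S)
  obtain ⟨z, rfl⟩ := hsurj s
  refine ⟨z, z.2, by rwa [hD], fun s => ?_⟩
  obtain ⟨w, rfl⟩ := hsurj s
  rw [← LieModuleHom.map_lie]
  exact hq _ (hab _ z.2 _ w.2)

end Chief

/-! ### Projective covers and the radical -/

section Cover

variable {A : Type*} [Ring A] {M P : Type*} [AddCommGroup M] [Module A M] [AddCommGroup P]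
  [Module A P]

/-- Nakayama's lemma with a nilpotent radical, so that `P` need not be known to be finitely
generated: lifts of generators of `M` span `N` with `P = N + ker π = N + JP`, and iterating gives `P
= N + J^n P`. -/
theorem IsProjectiveCover.finite [IsArtinianRing A] {π : P →ₗ[A] M} (hπ : IsProjectiveCover π)
    [Module.Finite A M] : Module.Finite A P := by
  obtain ⟨s, hs⟩ := (Module.Finite.fg_top : (⊤ : Submodule A M).FG)
  choose g hg using hπ.surjective
  let N : Submodule A P := Submodule.span A (g '' s)
  have hN : N ⊔ Ring.jacobson A • (⊤ : Submodule A P) = ⊤ := by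
    refine eq_top_iff.mpr (le_trans ?_ (sup_le_sup_left hπ.ker_le N))
    have hmap : N.map π = ⊤ := by
      rw [Submodule.map_span, ← Set.image_comp, show π ∘ g = id from funext hg, Set.image_id, hs]
    rw [← Submodule.comap_map_eq, hmap, Submodule.comap_top]
  have hpow : ∀ n : ℕ, N ⊔ Ring.jacobson A ^ n • (⊤ : Submodule A P) = ⊤ := by
    intro n
    induction n with
    | zero => rw [Submodule.pow_zero, Ideal.one_eq_top, Submodule.top_smul, sup_top_eq]
    | succ n ih =>
      refine eq_top_iff.mpr (ih.ge.trans (sup_le le_sup_left ?_))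
      nth_rw 1 [← hN]
      rw [Submodule.smul_sup, Submodule.pow_succ, Submodule.mul_smul]
      exact sup_le_sup_right Submodule.smul_le_right _
  obtain ⟨n, hn⟩ := (IsSemiprimaryRing.isNilpotent : IsNilpotent (Ring.jacobson A))
  have := hpow n
  rw [hn, Submodule.zero_eq_bot, Submodule.bot_smul, sup_bot_eq] at this
  exact ⟨this ▸ Submodule.fg_span (s.finite_toSet.image g)⟩

/-- Homomorphisms to simple modules vanish on `Jac(A) P`. -/
theorem loewySeries_one_le_ker [IsSimpleModule A M] (π : P →ₗ[A] M) :
    loewySeries A P 1 ≤ LinearMap.ker π := by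
  rw [loewySeries, Submodule.pow_one, Submodule.smul_le]
  intro r hr q _
  rw [LinearMap.mem_ker, map_smul]
  exact Module.mem_annihilator.mp (IsSemisimpleModule.jacobson_le_annihilator A M hr) _

end Cover

theorem isIrreducible_trivialLieModule {F L : Type*} [Field F] [LieRing L] :
    LieModule.IsIrreducible F L (TrivialLieModule F L F) := by
  have : Nontrivial (TrivialLieModule F L F) := inferInstanceAs (Nontrivial F)
  refine LieModule.IsIrreducible.mk fun N hN => ?_
  obtain ⟨v, hv, hv0⟩ : ∃ v ∈ N, v ≠ 0 := by
    by_contra! h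
    exact hN ((LieSubmodule.eq_bot_iff N).mpr h)
  refine eq_top_iff.mpr fun w _ => ?_
  let v' : F := v
  let w' : F := w
  have hv' : v' ≠ 0 := hv0
  have : w = (w' / v') • v := (div_mul_cancel₀ w' hv').symm
  rw [this]
  exact N.smul_mem _ hv

/-! ### Maps from the second Loewy layer to `S` -/

section Layer

variable {F L : Type*} [Field F] [LieRing L] [LieAlgebra F L] {p : ℕ} (φ : PMap F L p)

/-- The `u(L)`-linear map given by a homomorphism of restricted modules. -/
def AsModule.map {V W : Type*} [AddCommGroup V] [Module F V] [LieRingModule L V] [LieModule F L V]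
    [IsRestrictedModule φ V] [AddCommGroup W] [Module F W] [LieRingModule L W] [LieModule F L W]
    [IsRestrictedModule φ W] (g : V →ₗ⁅F, L⁆ W) : AsModule φ V →ₗ[φ.Env] AsModule φ W where
  toFun v := of φ W (g ((of φ V).symm v))
  map_add' u v := by rw [map_add, map_add, map_add]
  map_smul' a := by
    rw [RingHom.id_apply]
    have h : ∀ v : V, of φ W (g ((of φ V).symm (a • of φ V v))) = a • of φ W (g v) := by
      induction a using φ.env_induction with
      | hc c => intro v; rw [algebraMap_smul_of, algebraMap_smul_of]; exact map_smul g c v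
      | hι x => intro v; rw [ι_smul_of, ι_smul_of]; exact LieModuleHom.map_lie g x v
      | hadd a b ha hb =>
        intro v
        rw [add_smul, add_smul, ← ha, ← hb, map_add, map_add, map_add]
      | hmul a b ha hb =>
        intro v
        rw [mul_smul, mul_smul, ← hb, ← ha]
        rfl
    exact h

namespace CocycleExtension

variable {S : Type*} [AddCommGroup S] [Module F S] [LieRingModule L S] [LieModule F L S]
  (D : LieDerivation F L S)

/-- The inclusion of `S`. -/
def inlHom : S →ₗ⁅F, L⁆ CocycleExtension D where
  toFun s := mk D s 0
  map_add' s t := by ext <;> simp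
  map_smul' c s := by ext <;> simp
  map_lie' {x s} := by ext <;> simp

/-- The projection to the trivial module. -/
def sndHom : CocycleExtension D →ₗ⁅F, L⁆ TrivialLieModule F L F where
  toLinearMap := (TrivialLieModule.equiv F L F).symm.toLinearMap ∘ₗ snd D
  map_lie' := rfl

end CocycleExtension

variable [Fact p.Prime] [CharP F p] {φ}
  {P : Type*} [AddCommGroup P] [Module φ.Env P]
  {S : Type*} [AddCommGroup S] [Module F S] [LieRingModule L S] [LieModule F L S]
  [IsRestrictedModule φ S]

/-- A cocycle `D : L → S` gives a map `f : P → S` satisfying the twisted linearity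
`f(x q) = x f(q) + π(q) D(x)`, which induces a linear map on the second Loewy layer. -/
theorem exists_layer_hom [Module.Projective φ.Env P]
    (π : P →ₗ[φ.Env] AsModule φ (TrivialLieModule F L F))
    (hS : LieModule.IsIrreducible F L S) (hS' : ¬ LieModule.IsTrivial L S)
    (D : LieDerivation F L S) :
    ∃ (f : P → AsModule φ S) (h : LoewyLayer φ.Env P 2 →ₗ[φ.Env] AsModule φ S),
      (∀ x q, f (φ.ι x • q) = φ.ι x • f q +
        AsModule.of φ S (TrivialLieModule.equiv F L F ((AsModule.of φ _).symm (π q)) • D x)) ∧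
      ∀ q : loewySeries φ.Env P 1, h (Submodule.Quotient.mk q) = f q := by
  have := CocycleExtension.isRestrictedModule φ hS hS' D
  have hsimp := AsModule.isSimpleModule φ hS
  have hsimp' := AsModule.isSimpleModule φ (isIrreducible_trivialLieModule (F := F) (L := L))
  have hsurj : Function.Surjective (AsModule.map φ (CocycleExtension.sndHom D)) :=
    fun c => ⟨AsModule.of φ _ (CocycleExtension.mk D 0
      (TrivialLieModule.equiv F L F ((AsModule.of φ _).symm c))), rfl⟩
  obtain ⟨g, hg⟩ := Module.projective_lifting_property _ π hsurj
  let f : P → AsModule φ S :=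
    fun q => AsModule.of φ S (CocycleExtension.fst D ((AsModule.of φ _).symm (g q)))
  have hsnd : ∀ q, CocycleExtension.snd D ((AsModule.of φ _).symm (g q)) =
      TrivialLieModule.equiv F L F ((AsModule.of φ _).symm (π q)) := by
    intro q
    rw [← hg]
    rfl
  have hfadd : ∀ q r, f (q + r) = f q + f r := by
    intro q r
    simp only [f, map_add]
  -- `π` vanishes on `JP`, so there the lift `g` takes values in `S`, and its `S`-component becomes
  -- `u(L)`-linear.
  have hinl : ∀ q ∈ loewySeries φ.Env P 1,
      g q = AsModule.map φ (CocycleExtension.inlHom D) (f q) := by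
    intro q hq
    refine (AsModule.of φ (CocycleExtension D)).symm.injective (CocycleExtension.ext rfl ?_)
    rw [hsnd, LinearMap.mem_ker.mp (loewySeries_one_le_ker π hq)]
    rfl
  have hfsmul : ∀ (a : φ.Env), ∀ q ∈ loewySeries φ.Env P 1, f (a • q) = a • f q := by
    intro a q hq
    change AsModule.of φ S (CocycleExtension.fst D ((AsModule.of φ _).symm (g (a • q)))) = _
    rw [map_smul, hinl q hq, ← map_smul]
    rfl
  let f' : loewySeries φ.Env P 1 →ₗ[φ.Env] AsModule φ S :=
    { toFun := fun q => f q
      map_add' := fun q r => hfadd q r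
      map_smul' := fun a q => hfsmul a q q.2 }
  have hker : (loewySeries φ.Env P 2).submoduleOf (loewySeries φ.Env P 1) ≤ LinearMap.ker f' := by
    rintro ⟨q, hq1⟩ hq
    have hq2 : q ∈ Ring.jacobson φ.Env • loewySeries φ.Env P 1 := by
      have h2 : Ring.jacobson φ.Env ^ 2 = Ring.jacobson φ.Env * Ring.jacobson φ.Env ^ 1 :=
        Submodule.pow_succ' _ one_ne_zero
      rw [loewySeries, ← Submodule.mul_smul, ← h2]
      exact hq
    change f q = 0
    clear hq hq1
    induction hq2 using Submodule.smul_induction_on' with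
    | smul r hr n hn =>
      rw [hfsmul r n hn]
      exact Module.mem_annihilator.mp (IsSemisimpleModule.jacobson_le_annihilator φ.Env _ hr) _
    | add x _ y _ hx hy => rw [hfadd, hx, hy, add_zero]
  refine ⟨f, Submodule.liftQ _ f' hker, fun x q => ?_, fun q => rfl⟩
  change AsModule.of φ S (CocycleExtension.fst D ((AsModule.of φ _).symm (g (φ.ι x • q)))) = _
  rw [map_smul, ← hsnd]
  change AsModule.of φ S (CocycleExtension.fst D ((AsModule.of φ _).symm
    (φ.ι x • AsModule.of φ _ ((AsModule.of φ _).symm (g q))))) = φ.ι x • AsModule.of φ S _ + _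
  rw [AsModule.ι_smul_of, AsModule.ι_smul_of, ← map_add]
  rfl

end Layer

end RestrictedLie

/-! ### The main theorem -/

open RestrictedLie in
theorem theorem5p1 {F L : Type*} [Field F] [LieRing L] [LieAlgebra F L] [Module.Finite F L]
    (p : ℕ) [Fact p.Prime] [CharP F p] (φ : PMap F L p)
    {P : Type*} [AddCommGroup P] [Module φ.Env P]
    (π : P →ₗ[φ.Env] AsModule φ (TrivialLieModule F L F)) (hπ : IsProjectiveCover π)
    {S : Type*} [AddCommGroup S] [Module F S] [LieRingModule L S] [LieModule F L S]
    [IsRestrictedModule φ S] (hS : LieModule.IsIrreducible F L S)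
    (hS' : ¬ LieModule.IsTrivial L S) (c : ChiefSeries F L) :
    (c.splitMultiplicity S : ℕ∞) ≤
      compositionMultiplicity φ.Env (LoewyLayer φ.Env P 2) (AsModule φ S) := by
  classical
  have hnt : Nontrivial S := (LieSubmodule.nontrivial_iff F L S).mp hS.toNontrivial
  have hsimp := AsModule.isSimpleModule φ hS
  have hsimp' := AsModule.isSimpleModule φ (isIrreducible_trivialLieModule (F := F) (L := L))
  have hfin := φ.env_finite (Fact.out : p.Prime).two_le
  have : IsArtinianRing φ.Env := IsArtinianRing.of_finite F φ.Env
  have hPfin : Module.Finite φ.Env P := hπ.finite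
  have := hπ.projective
  let good : Fin c.length → Prop := fun j =>
    IsAbelianFactor (c.ideal j.castSucc) (c.ideal j.succ) ∧
    Nonempty (ChiefFactor (c.ideal j.castSucc) (c.ideal j.succ) ≃ₗ⁅F, L⁆ S) ∧
    IsSplitFactor (c.ideal j.castSucc) (c.ideal j.succ)
  have hD : ∀ j, ∃ D : LieDerivation F L S, good j → (∀ x ∈ c.ideal j.castSucc, D x = 0) ∧
      ∃ x ∈ c.ideal j.succ, D x ≠ 0 ∧ ∀ s : S, ⁅x, s⁆ = 0 := by
    intro j
    by_cases hj : good j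
    · obtain ⟨hab, ⟨e⟩, hs⟩ := hj
      obtain ⟨D, hD⟩ := exists_lieDerivation_of_chiefFactor (c.covBy j).le hab e hs
      exact ⟨D, fun _ => hD⟩
    -- A default value at the indices that are not counted, so that the family is indexed by all of
    -- `Fin c.length`.
    · exact ⟨0, fun h => absurd h hj⟩
  choose D hD using hD
  choose f h hf hh using fun j => exists_layer_hom π hS hS' (D j)
  have hcard : c.splitMultiplicity S = (Finset.univ.filter good).card := by
    rw [← Fintype.card_subtype, ← Nat.card_eq_fintype_card]
    rfl
  rw [hcard]
  refine card_le_compositionMultiplicity h _ fun a ha G hG haG hle => ?_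
  -- If independence failed, `h a` would be a combination of the `h i` with `i > a`; evaluating at
  -- the class of `x q` refutes this.
  obtain ⟨d, hd⟩ := exists_eq_sum_of_inf_ker_le h (h a) G hle
  obtain ⟨-, x, hx, hDx, hxS⟩ := hD a (Finset.mem_filter.mp ha).2
  obtain ⟨q, hq⟩ := hπ.surjective (AsModule.of φ _ ((TrivialLieModule.equiv F L F).symm 1))
  have hι0 : ∀ s : AsModule φ S, φ.ι x • s = 0 := fun s =>
    (AsModule.ι_smul_of φ x ((AsModule.of φ S).symm s)).trans (hxS _)
  have hfq : ∀ j, f j (φ.ι x • q) = AsModule.of φ S (D j x) := by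
    intro j
    rw [hf, hι0, hq, zero_add, AddEquiv.symm_apply_apply, LinearEquiv.apply_symm_apply, one_smul]
  -- `x` acts as zero on the trivial module, so `x q ∈ ker π ⊆ JP`.
  have hmem : φ.ι x • q ∈ loewySeries φ.Env P 1 := by
    rw [loewySeries, Submodule.pow_one]
    refine hπ.ker_le ?_
    rw [LinearMap.mem_ker, map_smul, hq, AsModule.ι_smul_of]
    rfl
  have h0 : ∀ i ∈ G, h i (Submodule.Quotient.mk ⟨_, hmem⟩) = 0 := by
    intro i hi
    rw [hh i ⟨_, hmem⟩]
    refine (hfq i).trans ?_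
    -- As `a < i`, the upper ideal at `a` lies in the lower ideal at `i`, where `D i` vanishes.
    rw [(hD i (Finset.mem_filter.mp (hG hi)).2).1 x
      (c.monotone_ideal (Fin.succ_le_castSucc_iff.mpr (haG i hi)) hx), map_zero]
  have key := hd (Submodule.Quotient.mk ⟨_, hmem⟩)
  rw [Finset.sum_eq_zero fun i hi => by rw [h0 i hi, map_zero], hh a ⟨_, hmem⟩] at key
  exact hDx ((AsModule.of φ S).injective ((hfq a).symm.trans key))
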